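/- Let $\mathbb T=\{z\in\mathbb C:|z|=1\}$ and let $C(\mathbb T)$ be the space of continuous functions $f:\mathbb T\to\mathbb C$. Let $C_p(\mathbb T)$ be $C(\mathbb T)$ with the topology of pointwise convergence. For $k=1,2,\dots$ put $J_k=\{e^{it}:0\le t\le 2\pi-\tfrac1k\}$ and $p_k(f)=\sup_{z\in J_k}|f(z)|$, and let $\tau$ be the locally convex topology on $C(\mathbb T)$ defined by the seminorms $p_k$, $k\ge1$ (that is, uniform convergence on each arc $J_k$). A bilateral series $\sum_{n=-\infty}^{\infty}x_n$ in a topological vector space $X$ is called universal if for every $x\in X$ there is a strictly increasing sequence $(n_k)_{k\ge0}$ of positive integers with $\sum_{j=-n_k}^{n_k}x_j\to x$ as $k\to\infty$. A sequence $c=(c_n)_{n\ge0}$ of positive real numbers belongs to the class $\mathcal X_+$ if $$\lim_{n\to\infty}n(c_{n+1}-c_n)=+\infty\quad\text{and}\quad\sum_{n=0}^\infty\frac{c_n}{n^2+1}=\infty .$$ **Theorem.** The topology $\tau$ is metrizable and stronger than (that is, contains) the topology of $C_p(\mathbb T)$. For every $c\in\mathcal X_+$ there exists a sequence $a=(a_n)_{n\in\mathbb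 Z}$ of complex numbers such that 1. $|a_n|\le e^{c_{|n|}}$ for every $n\in\mathbb Z$; 2. the trigonometric series $\sum_{n=-\infty}^\infty a_nz^n$ is universal in $C_p(\mathbb T)$; that is, every $g\in C(\mathbb T)$ is the pointwise limit on $\mathbb T$ of $\sum_{j=-m_k}^{m_k}a_jz^j$ for some strictly increasing sequence $(m_k)_{k\ge0}$ of positive integers; 3. for the same $a$, the series $\sum_{n=-\infty}^\infty a_nz^n$ is universal even in $C(\mathbb T)$ with the topology $\tau$. -/

import Mathlib

open Filter Topology

noncomputable section

namespace UniversalTrig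

/-- The class `X₊`: sequences of positive reals with `n (c_{n+1} - c_n) → +∞` and
`∑ c_n / (n² + 1) = ∞` (a series of positive terms, so divergence means non-summability). -/
structure ClassXPlus (c : ℕ → ℝ) : Prop where
  pos : ∀ n, 0 < c n
  tendsto_growth : Tendsto (fun n : ℕ => (n : ℝ) * (c (n + 1) - c n)) atTop atTop
  diverges : ¬ Summable (fun n : ℕ => c n / ((n : ℝ) ^ 2 + 1))

/-- A bilateral series `∑ x_n` in the space `X` with the topology `t` is universal if every point
of `X` is the limit of `∑_{j=-n_k}^{n_k} x_j` for some strictly increasing sequence `n_k` of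
positive integers. -/
def IsUniversalSeries {X : Type*} [AddCommGroup X] (t : TopologicalSpace X) (x : ℤ → X) : Prop :=
  ∀ y : X, ∃ n : ℕ → ℕ, StrictMono n ∧ (∀ k, 0 < n k) ∧
    Tendsto (fun k => ∑ j ∈ Finset.Icc (-(n k : ℤ)) (n k : ℤ), x j) atTop (@nhds X t y)

/-- The function `z ↦ z ^ n` on the unit circle. -/
def monomial (n : ℤ) : C(Circle, ℂ) where
  toFun z := (z : ℂ) ^ n
  continuous_toFun := Continuous.zpow₀ (by fun_prop) n fun z => Or.inl z.coe_ne_zero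

/-- The partial sum `S^a_m(z) = ∑_{k=-m}^{m} a_k z^k`. -/
def partialSum (a : ℤ → ℂ) (m : ℕ) (z : Circle) : ℂ :=
  ∑ k ∈ Finset.Icc (-(m : ℤ)) (m : ℤ), a k * (z : ℂ) ^ k

/-- The set `R_a(J)` of the continuous functions on `J` that are pointwise limits on `J` of a
subsequence of the partial sums `S^a_m`. -/
def limitFunctions (a : ℤ → ℂ) (J : Set Circle) : Set C(J, ℂ) :=
  {g | ∃ m : ℕ → ℕ, StrictMono m ∧ (∀ k, 0 < m k) ∧
    ∀ z : J, Tendsto (fun k => partialSum a (m k) z) atTop (𝓝 (g z))}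

/-- The topology of pointwise convergence on `C(𝕋)`; with it, `C(𝕋)` is the space `C_p(𝕋)`. -/
@[reducible] def pointwiseTopology : TopologicalSpace C(Circle, ℂ) :=
  TopologicalSpace.induced (fun (f : C(Circle, ℂ)) (z : Circle) => f z) Pi.topologicalSpace

/-- The arc `J_k = {e^{it} : 0 ≤ t ≤ 2π - 1/k}`, `k ≥ 1`. -/
def arc (k : ℕ+) : Set Circle :=
  (fun t : ℝ => Circle.exp t) '' Set.Icc 0 (2 * Real.pi - 1 / ((k : ℕ) : ℝ))

lemma bddAbove_arc (k : ℕ+) (f : C(Circle, ℂ)) :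
    BddAbove (Set.range fun z : arc k => ‖f z‖) :=
  ⟨‖f‖, by rintro _ ⟨z, rfl⟩; exact f.norm_coe_le_norm z⟩

/-- The seminorm `p_k(f) = sup_{z ∈ J_k} |f(z)|` on `C(𝕋)`. -/
def arcSeminorm (k : ℕ+) : Seminorm ℂ C(Circle, ℂ) :=
  Seminorm.of (fun f => ⨆ z : arc k, ‖f z‖)
    (fun f g => by
      refine Real.iSup_le (fun z => ?_) (add_nonneg (Real.iSup_nonneg fun _ => norm_nonneg _)
        (Real.iSup_nonneg fun _ => norm_nonneg _))
      exact (norm_add_le _ _).trans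
        (add_le_add (le_ciSup (bddAbove_arc k f) z) (le_ciSup (bddAbove_arc k g) z)))
    (fun r f => by
      simp only [ContinuousMap.coe_smul, Pi.smul_apply, norm_smul]
      exact (Real.mul_iSup_of_nonneg (norm_nonneg r) _).symm)

/-- The locally convex topology `τ` on `C(𝕋)` defined by the seminorms `p_k`, `k ≥ 1`. -/
@[reducible] def tauTopology : TopologicalSpace C(Circle, ℂ) :=
  SeminormFamily.moduleFilterBasis (𝕜 := ℂ) (arcSeminorm : SeminormFamily ℂ C(Circle, ℂ) ℕ+)
    |>.topology

end UniversalTrig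

end

/-! It suffices that polynomials having only terms of degree above N, with nth coefficient at most
e^{c_n} in modulus, are uniformly dense on each arc (`exists_admissible_approx`). Blocks in disjoint
degree ranges, each correcting the sum so far towards the next target, then glue into one power
series; the targets run through a dense sequence, each member recurring infinitely often. This
series is universal for τ, hence for the weaker pointwise topology.

Density is by duality. Pull the arc back to [0, L] with L < 2π. If some g were not approximable,
Hahn–Banach would give a functional ψ with |ψ(e^{inθ})| ≤ u e^{-c_n} for n > N. The function H(z) =
ψ(e^{izθ}) is entire and bounded on the closed upper half-plane. Since L < 2π, smallness at the
integers passes to the real points between them (`exists_norm_apply_expFun_le`). Divergence of ∑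
c_n/(n² + 1) then says that log|H| is too negative along the positive axis, which forces H = 0
(`eq_zero_of_bounded_of_decay`). So ψ kills e^{inθ} for all integers n, negative ones included,
hence every continuous function on the circle, against the separation. -/

noncomputable section

namespace UniversalTrig

/-! ### Uniqueness from dyadic decay near a boundary point -/

/-- The product of a `T`-periodic function over the translates by `k T / n` is `T / n`-periodic. -/
lemma periodic_prod_translates {g : ℝ → ℂ} {T : ℝ} (hg : Function.Periodic g T) {n : ℕ}
    (hn : 0 < n) :
    Function.Periodic (fun β => ∏ k ∈ Finset.range n, g (β + k * (T / n))) (T / n) := by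
  intro β
  obtain ⟨m, rfl⟩ : ∃ m, n = m + 1 := ⟨n - 1, by omega⟩
  have hT : g (β + T / ((m + 1 : ℕ) : ℝ) + (m : ℝ) * (T / ((m + 1 : ℕ) : ℝ))) = g β := by
    rw [← hg β]
    congr 1
    push_cast
    field_simp
    ring
  simp only
  rw [Finset.prod_range_succ, hT, Finset.prod_range_succ']
  congr 1
  · refine Finset.prod_congr rfl fun k _ => ?_
    congr 1
    push_cast
    ring
  · simp

/-- For 2^t ≤ k < 2^{t+1} the point β + kT/2^J lies in (0, T/2^{J-1-t}], so each of these 2^t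
factors gains σ^{e(J-1-t)}. The factor k = 0 is bounded by A alone. -/
lemma norm_prod_dyadic_le {g : ℝ → ℂ} {T A σ : ℝ} (hA : 0 ≤ A) (hσ0 : 0 ≤ σ)
    (hσ1 : σ ≤ 1) {e : ℕ → ℕ} (hT : 0 < T)
    (hb : ∀ j, ∀ β ∈ Set.Ioc 0 (T / 2 ^ j), ‖g β‖ ≤ A * σ ^ e j) (J : ℕ) {β : ℝ}
    (hβ : β ∈ Set.Ioc 0 (T / 2 ^ J)) (t : ℕ) (ht : t ≤ J) :
    ‖∏ k ∈ Finset.range (2 ^ t), g (β + k * (T / 2 ^ J))‖ ≤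
      A ^ 2 ^ t * σ ^ ∑ s ∈ Finset.range t, 2 ^ s * e (J - 1 - s) := by
  induction t with
  | zero =>
    simpa using (hb J β hβ).trans (mul_le_of_le_one_right hA (pow_le_one₀ hσ0 hσ1))
  | succ t ih =>
    rw [pow_succ, mul_two, Finset.prod_range_add, norm_mul, pow_add, Finset.sum_range_succ,
      pow_add σ, mul_mul_mul_comm]
    refine mul_le_mul (ih (by omega)) ?_ (norm_nonneg _) (by positivity)
    rw [norm_prod]
    have : A ^ 2 ^ t * σ ^ (2 ^ t * e (J - 1 - t)) =
        ∏ k ∈ Finset.range (2 ^ t), A * σ ^ e (J - 1 - t) := by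
      rw [Finset.prod_const, Finset.card_range, mul_pow, mul_comm (2 ^ t), pow_mul]
    rw [this]
    refine Finset.prod_le_prod (fun _ _ => norm_nonneg _) fun k hk => hb _ _ ⟨?_, ?_⟩
    · have := hβ.1
      positivity
    · have hk' : (k : ℝ) + 1 ≤ 2 ^ t := by exact_mod_cast Finset.mem_range.1 hk
      have hJ : (2 : ℝ) ^ J = 2 ^ (J - 1 - t) * (2 ^ t * 2) := by
        rw [← pow_succ, ← pow_add]; congr 1; omega
      calc β + ((2 ^ t + k : ℕ) : ℝ) * (T / 2 ^ J)
          ≤ T / 2 ^ J + ((2 ^ t + k : ℕ) : ℝ) * (T / 2 ^ J) := by linarith [hβ.2]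
        _ = ((2 : ℝ) ^ t + (k + 1)) * (T / 2 ^ J) := by push_cast; ring
        _ ≤ (2 ^ t + 2 ^ t) * (T / 2 ^ J) := by gcongr
        _ = T / 2 ^ (J - 1 - t) := by rw [hJ]; field_simp; ring

/-- A submean value inequality: bounds for an analytic function on dyadic boundary arcs at `1`
bound its value at the centre of the disc. -/
lemma norm_zero_pow_le {G : ℂ → ℂ} (hG : DiffContOnCl ℂ G (Metric.ball 0 1)) {A σ : ℝ}
    (hA : 0 ≤ A) (hσ0 : 0 ≤ σ) (hσ1 : σ ≤ 1) {e : ℕ → ℕ}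
    (hb : ∀ j, ∀ β : ℝ, β ∈ Set.Ioc 0 (2 * Real.pi / 2 ^ j) →
      ‖G (Complex.exp (-(β * Complex.I)))‖ ≤ A * σ ^ e j) (J : ℕ) :
    ‖G 0‖ ^ 2 ^ J ≤ A ^ 2 ^ J * σ ^ ∑ s ∈ Finset.range J, 2 ^ s * e (J - 1 - s) := by
  set T : ℝ := 2 * Real.pi with hT
  have hTpos : 0 < T := Real.two_pi_pos
  set g : ℝ → ℂ := fun β => G (Complex.exp (-(β * Complex.I))) with hg
  have hgper : Function.Periodic g T := by
    intro β
    simp only [hg, hT]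
    congr 1
    rw [Complex.exp_eq_exp_iff_exists_int]
    exact ⟨-1, by push_cast; ring⟩
  set rot : ℕ → ℂ := fun k => Complex.exp (-(((k * (T / 2 ^ J) : ℝ) : ℂ) * Complex.I)) with hrot
  have hrotn : ∀ k, ‖rot k‖ = 1 := fun k => by
    simp only [hrot]
    rw [← neg_mul, ← Complex.ofReal_neg, Complex.norm_exp_ofReal_mul_I]
  -- The product over all rotations by 2π/2^J turns the maximum principle into an averaged bound:
  -- P(0) = G(0)^{2^J}, and on the circle every factor contributes its own decay.
  set P : ℂ → ℂ := fun w => ∏ k ∈ Finset.range (2 ^ J), G (rot k * w) with hP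
  have hPd : DiffContOnCl ℂ P (Metric.ball 0 1) := by
    constructor
    · refine DifferentiableOn.fun_finsetProd fun k _ => ?_
      refine hG.1.comp (by fun_prop) fun w hw => ?_
      simpa [hrotn] using hw
    · refine continuousOn_finsetProd _ fun k _ => ?_
      refine hG.2.comp (by fun_prop) fun w hw => ?_
      rw [closure_ball _ one_ne_zero] at hw ⊢
      simpa [hrotn] using hw
  have hP0 : P 0 = G 0 ^ 2 ^ J := by simp [hP]
  rw [← norm_pow, ← hP0]
  refine Complex.norm_le_of_forall_mem_frontier_norm_le Metric.isBounded_ball hPd ?_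
    (subset_closure (Metric.mem_ball_self one_pos))
  intro w hw
  rw [frontier_ball _ one_ne_zero, mem_sphere_zero_iff_norm] at hw
  obtain ⟨β, rfl⟩ : ∃ β : ℝ, w = Complex.exp (-(β * Complex.I)) := by
    refine ⟨-w.arg, ?_⟩
    have := Complex.norm_mul_exp_arg_mul_I w
    rw [hw] at this
    simpa using this.symm
  have hPg : P (Complex.exp (-(β * Complex.I))) =
      ∏ k ∈ Finset.range (2 ^ J), g (β + k * (T / (2 ^ J : ℕ))) := by
    refine Finset.prod_congr rfl fun k _ => ?_
    simp only [hrot, hg]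
    rw [← Complex.exp_add]
    congr 2
    push_cast
    ring
  rw [hPg]
  -- On the circle the product has period T/2^J in the angle, so only angles in (0, T/2^J] matter.
  obtain ⟨β', hβ', h⟩ := (periodic_prod_translates hgper (n := 2 ^ J) (by positivity)).exists_mem_Ioc
    (by positivity) β 0
  rw [h]
  simp only [Nat.cast_pow, Nat.cast_ofNat, zero_add] at hβ' ⊢
  exact norm_prod_dyadic_le hA hσ0 hσ1 hTpos hb J hβ' J le_rfl

/-- A discrete Jensen inequality: if G(0) ≠ 0, taking logarithms in `norm_zero_pow_le` and dividing
by 2^J bounds the partial sums of e_j/2^j uniformly in J. -/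
lemma eq_zero_of_dyadic_arc_bounds {G : ℂ → ℂ} (hG : DiffContOnCl ℂ G (Metric.ball 0 1)) {A σ : ℝ}
    (hA : 0 < A) (hσ0 : 0 < σ) (hσ1 : σ < 1) {e : ℕ → ℕ}
    (hb : ∀ j, ∀ β : ℝ, β ∈ Set.Ioc 0 (2 * Real.pi / 2 ^ j) →
      ‖G (Complex.exp (-(β * Complex.I)))‖ ≤ A * σ ^ e j)
    (he : ¬ Summable fun j => (e j : ℝ) / 2 ^ j) : G 0 = 0 := by
  by_contra h0
  have hg : 0 < ‖G 0‖ := norm_pos_iff.2 h0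
  have hl : 0 < -Real.log σ := by linarith [Real.log_neg hσ0 hσ1]
  refine he (summable_of_sum_range_le (c := 2 * (Real.log A - Real.log ‖G 0‖) / -Real.log σ)
    (fun _ => by positivity) fun J => ?_)
  have h1 := Real.log_le_log (by positivity) (norm_zero_pow_le hG hA.le hσ0.le hσ1.le hb J)
  rw [Real.log_mul (by positivity) (by positivity), Real.log_pow, Real.log_pow, Real.log_pow] at h1
  have h2 : ((∑ s ∈ Finset.range J, 2 ^ s * e (J - 1 - s) : ℕ) : ℝ) =
      2 ^ J / 2 * ∑ j ∈ Finset.range J, (e j : ℝ) / 2 ^ j := by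
    rw [← Finset.sum_range_reflect, Finset.mul_sum]
    push_cast
    refine Finset.sum_congr rfl fun j hj => ?_
    have hj' := Finset.mem_range.1 hj
    have hJ : (2 : ℝ) ^ J = 2 ^ (J - 1 - j) * (2 ^ j * 2) := by
      rw [← pow_succ, ← pow_add]; congr 1; omega
    rw [hJ, show J - 1 - (J - 1 - j) = j by omega]
    field_simp
  rw [h2] at h1
  push_cast at h1
  rw [le_div_iff₀ hl]
  have h3 : (0 : ℝ) < 2 ^ J := by positivity
  nlinarith

lemma inv_le_cos_div_sin {θ : ℝ} (h0 : 0 < θ) (h1 : θ ≤ 1) :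
    1 / (2 * θ) ≤ Real.cos θ / Real.sin θ := by
  have hs : 0 < Real.sin θ := Real.sin_pos_of_pos_of_le_one h0 h1
  have hc : 1 / 2 ≤ Real.cos θ := by
    have := Real.one_sub_sq_div_two_le_cos (x := θ)
    nlinarith
  rw [div_le_div_iff₀ (by positivity) hs]
  nlinarith [Real.sin_le h0.le]

/-- A boundary uniqueness theorem in the upper half-plane with a divergent logarithmic sum. -/
lemma eq_zero_of_bounded_of_decay {H : ℂ → ℂ} (hH : Differentiable ℂ H) {M C σ : ℝ}
    (hM : ∀ z : ℂ, 0 ≤ z.im → ‖H z‖ ≤ M) (hσ0 : 0 < σ) (hσ1 : σ < 1) {d : ℕ → ℕ} {i₀ : ℕ}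
    (hd : ∀ i, i₀ ≤ i → ∀ x : ℝ, 2 ^ (i + 1) ≤ x → ‖H x‖ ≤ C * σ ^ d i)
    (hdiv : ¬ Summable fun i => (d i : ℝ) / 2 ^ i) {ζ : ℂ} (hζ : 0 < ζ.im) : H ζ = 0 := by
  have hM0 : 0 ≤ M := (norm_nonneg _).trans (hM 0 le_rfl)
  -- Cayley map of the disc to the upper half-plane, with 0 ↦ ζ and 1 ↦ ∞.
  set φ : ℂ → ℂ := fun w => (ζ - (starRingEnd ℂ) ζ * w) / (1 - w) with hφ
  -- The factor 1 - w makes G continuous at 1, where H ∘ φ is merely bounded.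
  set G : ℂ → ℂ := fun w => (1 - w) * H (φ w) with hGdef
  have hG0 : G 0 = H ζ := by simp [hGdef, hφ]
  have him : ∀ w : ℂ, w ≠ 1 → ‖w‖ ≤ 1 → 0 ≤ (φ w).im := by
    intro w hw1 hw
    have hne : 1 - w ≠ 0 := sub_ne_zero.2 hw1.symm
    have hsq : w.re * w.re + w.im * w.im ≤ 1 := by
      rw [← Complex.normSq_apply, Complex.normSq_eq_norm_sq]
      nlinarith [norm_nonneg w]
    have hN : 0 < Complex.normSq (1 - w) := Complex.normSq_pos.2 hne
    have : (φ w).im = ζ.im * (1 - (w.re * w.re + w.im * w.im)) / Complex.normSq (1 - w) := by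
      simp only [hφ]
      rw [Complex.div_im]
      simp
      field_simp
      ring
    rw [this]
    exact div_nonneg (mul_nonneg hζ.le (by linarith)) hN.le
  have hGb : ∀ w : ℂ, ‖w‖ ≤ 1 → ‖G w‖ ≤ ‖1 - w‖ * M := by
    intro w hw
    by_cases hw1 : w = 1
    · simp [hGdef, hw1]
    · simp only [hGdef, norm_mul]
      gcongr
      exact hM _ (him w hw1 hw)
  have hφd : ∀ w : ℂ, w ≠ 1 → DifferentiableAt ℂ φ w := by
    intro w hw1
    have hne : 1 - w ≠ 0 := sub_ne_zero.2 hw1.symm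
    simp only [hφ]
    fun_prop (disch := exact hne)
  have hGd : ∀ w : ℂ, w ≠ 1 → DifferentiableAt ℂ G w := by
    intro w hw1
    exact ((differentiableAt_const _).sub differentiableAt_id).mul
      ((hH _).comp w (hφd w hw1))
  have hGcl : DiffContOnCl ℂ G (Metric.ball 0 1) := by
    constructor
    · intro w hw
      refine (hGd w ?_).differentiableWithinAt
      rintro rfl
      simp at hw
    · rw [closure_ball _ one_ne_zero]
      intro w hw
      by_cases hw1 : w = 1
      · subst hw1
        have hG1 : G 1 = 0 := by simp [hGdef]
        rw [ContinuousWithinAt, hG1]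
        refine squeeze_zero_norm' (a := fun w => ‖1 - w‖ * M) ?_ ?_
        · filter_upwards [self_mem_nhdsWithin] with w hw
          exact hGb w (by simpa using hw)
        · have : Tendsto (fun w : ℂ => ‖1 - w‖ * M) (𝓝 1) (𝓝 (‖(1 : ℂ) - 1‖ * M)) := by
            apply Continuous.tendsto
            fun_prop
          simp only [sub_self, norm_zero, zero_mul] at this
          exact this.mono_left nhdsWithin_le_nhds
      · exact (hGd w hw1).continuousAt.continuousWithinAt
  -- The boundary points e^{-iβ} with small β > 0 go to Re ζ + Im ζ · cot(β/2), that is, to large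
  -- positive reals.
  have hval : ∀ β : ℝ, 0 < β → β ≤ 1 → φ (Complex.exp (-(β * Complex.I))) =
      ((ζ.re + ζ.im * (Real.cos (β / 2) / Real.sin (β / 2)) : ℝ) : ℂ) := by
    intro β hβ0 hβ1
    have hs : 0 < Real.sin (β / 2) := Real.sin_pos_of_pos_of_le_one (by linarith) (by linarith)
    have hs' : (Real.sin (β / 2) : ℂ) ≠ 0 := by exact_mod_cast hs.ne'
    set s : ℂ := (Real.sin (β / 2) : ℂ) with hsdef
    set c : ℂ := (Real.cos (β / 2) : ℂ) with hcdef
    have hcs : c ^ 2 + s ^ 2 = 1 := by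
      rw [hsdef, hcdef]; exact_mod_cast Real.cos_sq_add_sin_sq (β / 2)
    have hE : Complex.exp (-(β * Complex.I)) = (c - s * Complex.I) ^ 2 := by
      have : Complex.exp (-((β / 2 : ℝ) * Complex.I)) = c - s * Complex.I := by
        rw [← neg_mul, Complex.exp_mul_I, Complex.cos_neg, Complex.sin_neg, hsdef, hcdef]
        push_cast
        ring
      rw [← this, ← Complex.exp_nat_mul]
      congr 1
      push_cast
      ring
    have hI : Complex.I ^ 2 = -1 := Complex.I_sq
    have hne : c - s * Complex.I ≠ 0 := by
      intro h
      have := Complex.exp_ne_zero (-(β * Complex.I))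
      rw [hE, h] at this
      simp at this
    have h1 : 1 - (c - s * Complex.I) ^ 2 = 2 * Complex.I * s * (c - s * Complex.I) := by
      linear_combination -hcs + s ^ 2 * hI
    have hne1 : 1 - (c - s * Complex.I) ^ 2 ≠ 0 := by
      rw [h1]
      exact mul_ne_zero (mul_ne_zero (mul_ne_zero two_ne_zero Complex.I_ne_zero) hs') hne
    simp only [hφ, hE]
    rw [div_eq_iff hne1]
    have hζe : ζ = (ζ.re : ℂ) + ζ.im * Complex.I := (Complex.re_add_im ζ).symm
    have hζc : (starRingEnd ℂ) ζ = (ζ.re : ℂ) - ζ.im * Complex.I := by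
      apply Complex.ext <;> simp
    have hq : ((ζ.re + ζ.im * (Real.cos (β / 2) / Real.sin (β / 2)) : ℝ) : ℂ) =
        (ζ.re : ℂ) + ζ.im * (c / s) := by
      rw [hsdef, hcdef]; push_cast; ring
    rw [hq, hζc]
    nth_rw 1 [hζe]
    rw [add_mul, h1]
    field_simp
    linear_combination (-(ζ.re : ℂ) - ζ.im * Complex.I) * hcs +
      ((ζ.re : ℂ) * s ^ 2 + ζ.im * Complex.I * s ^ 2) * hI
  -- For β ≤ 7/2^j one has cot(β/2) ≥ 2^j/7. The choice of m gives |Re ζ| ≤ 2^j Im ζ/56, leaving at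
  -- least 2^j Im ζ/8 because 1/7 - 1/56 = 1/8; the choice of l makes this at least 2^{j-l+1}.
  obtain ⟨l, hl⟩ : ∃ l : ℕ, 16 / ζ.im ≤ 2 ^ l := by
    obtain ⟨l, hl⟩ := pow_unbounded_of_one_lt (16 / ζ.im) (one_lt_two (α := ℝ))
    exact ⟨l, hl.le⟩
  obtain ⟨m, hm⟩ : ∃ m : ℕ, |ζ.re| * 56 / ζ.im ≤ 2 ^ m := by
    obtain ⟨l, hl⟩ := pow_unbounded_of_one_lt (|ζ.re| * 56 / ζ.im) (one_lt_two (α := ℝ))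
    exact ⟨l, hl.le⟩
  set j₁ := l + i₀ + m + 3 with hj₁
  -- An index shift by l and finitely many zeros leave the weighted sum divergent.
  set e : ℕ → ℕ := fun j => if j < j₁ then 0 else d (j - l) with he
  set A : ℝ := 2 * (max M C + 1) with hA
  have hA0 : 0 < A := by have := le_max_left M C; positivity
  rw [← hG0]
  refine eq_zero_of_dyadic_arc_bounds hGcl hA0 hσ0 hσ1 (e := e) ?_ ?_
  · intro j β hβ
    have hn1 : ‖Complex.exp (-(β * Complex.I))‖ = 1 := by
      rw [← neg_mul, ← Complex.ofReal_neg, Complex.norm_exp_ofReal_mul_I]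
    have h2 : ‖1 - Complex.exp (-(β * Complex.I))‖ ≤ 2 := by
      refine (norm_sub_le _ _).trans ?_
      rw [hn1, norm_one]; norm_num
    by_cases hj : j < j₁
    · simp only [he, hj, if_true, pow_zero, mul_one]
      calc _ ≤ _ := hGb _ hn1.le
        _ ≤ 2 * M := by gcongr
        _ ≤ A := by rw [hA]; linarith [le_max_left M C]
    · simp only [he, hj, if_false]
      push Not at hj
      have hp : (2 : ℝ) * Real.pi / 2 ^ j ≤ 7 / 2 ^ j := by
        gcongr; linarith [Real.pi_lt_d2]
      have h8 : (8 : ℝ) ≤ 2 ^ j := by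
        calc (8 : ℝ) = 2 ^ 3 := by norm_num
          _ ≤ 2 ^ j := pow_le_pow_right₀ one_le_two (by omega)
      have hβ7 : β ≤ 7 / 2 ^ j := hβ.2.trans hp
      have hβ1 : β ≤ 1 := hβ7.trans ((div_le_one (by positivity)).2 (by linarith))
      have hcot := inv_le_cos_div_sin (θ := β / 2) (by linarith [hβ.1]) (by linarith)
      have hcot' : (2 : ℝ) ^ j / 7 ≤ Real.cos (β / 2) / Real.sin (β / 2) := by
        refine le_trans ?_ hcot
        rw [div_le_div_iff₀ (by norm_num) (by linarith [hβ.1])]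
        rw [le_div_iff₀ (by positivity)] at hβ7
        linarith
      have hx : (2 : ℝ) ^ (j - l + 1) ≤
          ζ.re + ζ.im * (Real.cos (β / 2) / Real.sin (β / 2)) := by
        have e1 : ζ.im * (2 ^ j / 7) ≤ ζ.im * (Real.cos (β / 2) / Real.sin (β / 2)) := by gcongr
        have e2 : |ζ.re| * 56 ≤ 2 ^ j * ζ.im := by
          rw [div_le_iff₀ hζ] at hm
          refine hm.trans ?_
          gcongr
          · exact one_le_two
          · omega
        have e3 : (16 : ℝ) * 2 ^ (j - l) ≤ 2 ^ j * ζ.im := by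
          rw [div_le_iff₀ hζ] at hl
          have : (2 : ℝ) ^ j = 2 ^ l * 2 ^ (j - l) := by rw [← pow_add]; congr 1; omega
          rw [this]
          calc (16 : ℝ) * 2 ^ (j - l) ≤ (2 ^ l * ζ.im) * 2 ^ (j - l) := by gcongr
            _ = _ := by ring
        have e4 := neg_abs_le ζ.re
        rw [pow_succ]
        linarith
      simp only [hGdef, norm_mul]
      rw [hval β hβ.1 hβ1]
      have := hd (j - l) (by omega) _ hx
      calc _ ≤ 2 * (C * σ ^ d (j - l)) := by gcongr
        _ = (2 * C) * σ ^ d (j - l) := by ring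
        _ ≤ A * σ ^ d (j - l) := by
          gcongr
          rw [hA]
          linarith [le_max_right M C]
  · intro hs
    apply hdiv
    have h1 := (summable_nat_add_iff j₁).2 hs
    rw [← summable_nat_add_iff (j₁ - l)]
    have h2 := h1.mul_left ((2 : ℝ) ^ l)
    refine h2.congr fun n => ?_
    have hc : ¬ (n + j₁ < j₁) := by omega
    simp only [he, hc, if_false]
    rw [show n + j₁ - l = n + (j₁ - l) by omega, show n + j₁ = l + (n + (j₁ - l)) by omega,
      pow_add]
    field_simp

/-! ### Interpolation from integer to real frequencies -/

lemma norm_choose_le_one {s : ℝ} (hs : |s| ≤ 1) (k : ℕ) : ‖Ring.choose (s : ℂ) k‖ ≤ 1 := by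
  -- Factor by factor: |s - j| ≤ 1 + j, so the falling factorial is at most k!.
  have h : ‖(descPochhammer ℤ k).smeval (s : ℂ)‖ ≤ k.factorial := by
    induction k with
    | zero => simp
    | succ k ih =>
      rw [descPochhammer_succ_right, Polynomial.smeval_mul, norm_mul, Nat.factorial_succ,
        mul_comm]
      push_cast
      refine mul_le_mul ?_ ih (norm_nonneg _) (by positivity)
      simp only [Polynomial.smeval_sub, Polynomial.smeval_X, pow_one, Polynomial.smeval_natCast,
        pow_zero, nsmul_eq_mul, mul_one]
      refine (norm_sub_le _ _).trans ?_
      simp only [Complex.norm_real, Real.norm_eq_abs, Complex.norm_natCast]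
      linarith
  rw [Ring.descPochhammer_eq_factorial_smul_choose, nsmul_eq_mul, norm_mul,
    Complex.norm_natCast] at h
  have : (0 : ℝ) < k.factorial := by exact_mod_cast k.factorial_pos
  nlinarith

lemma norm_neg_one_pow_mul_choose_le_one {s : ℝ} (hs : |s| ≤ 1) (k : ℕ) :
    ‖(-1) ^ k * Ring.choose (s : ℂ) k‖ ≤ 1 := by
  rw [norm_mul, norm_pow, norm_neg, norm_one, one_pow, one_mul]
  exact norm_choose_le_one hs k

lemma hasSum_one_sub_cpow (s : ℂ) {y : ℂ} (hy : ‖y‖ < 1) :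
    HasSum (fun k => ((-1) ^ k * Ring.choose s k) * y ^ k) ((1 - y) ^ s) := by
  have h := (Complex.one_add_cpow_hasFPowerSeriesOnBall_zero (a := s)).hasSum (y := -y)
    (by rw [← ENNReal.ofReal_one, Metric.eball_ofReal]; simpa using hy)
  rw [zero_add, ← sub_eq_add_neg] at h
  convert! h using 2 with k
  rw [binomialSeries_apply, List.ofFn_const, List.prod_replicate, smul_eq_mul, neg_pow y]
  ring

/-- Since (1 + e^{iφ})/2 = cos(φ/2) e^{iφ/2}, the moduli cancel and the two arguments sφ/2 add up.
Both bases have the form 1 - y with |y| < 1, so fractional powers of e^{iφ} become binomial series.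
-/
lemma half_one_add_exp_cpow_mul {φ s : ℝ} (hφ : |φ| < Real.pi) :
    (1 - (1 - Complex.exp (φ * Complex.I)) / 2) ^ (s : ℂ) *
      (1 - (1 - Complex.exp (-(φ * Complex.I))) / 2) ^ ((-s : ℝ) : ℂ) =
      Complex.exp (s * φ * Complex.I) := by
  have key : ∀ (x : ℝ), |x| < Real.pi → ∀ t : ℝ,
      (1 - (1 - Complex.exp (x * Complex.I)) / 2) ^ (t : ℂ) =
        Complex.exp ((Real.log (Real.cos (x / 2)) + (x / 2) * Complex.I) * t) := by
    intro x hx t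
    obtain ⟨h1, h2⟩ := abs_lt.1 hx
    have hc : 0 < Real.cos (x / 2) :=
      Real.cos_pos_of_mem_Ioo ⟨by linarith, by linarith⟩
    have e1 : 1 - (1 - Complex.exp (x * Complex.I)) / 2 =
        (Real.cos (x / 2) : ℂ) * Complex.exp ((x / 2 : ℝ) * Complex.I) := by
      have e2 : Complex.exp (x * Complex.I) = Complex.exp ((x / 2 : ℝ) * Complex.I) ^ 2 := by
        rw [← Complex.exp_nat_mul]; congr 1; push_cast; ring
      have e3 : (Real.cos (x / 2) : ℂ) ^ 2 + (Real.sin (x / 2) : ℂ) ^ 2 = 1 := by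
        exact_mod_cast Real.cos_sq_add_sin_sq (x / 2)
      rw [e2, Complex.exp_mul_I, ← Complex.ofReal_cos, ← Complex.ofReal_sin]
      linear_combination (-1 / 2 : ℂ) * e3 + (Real.sin (x / 2) : ℂ) ^ 2 / 2 * Complex.I_sq
    rw [e1, Complex.cpow_def_of_ne_zero
      (mul_ne_zero (by exact_mod_cast hc.ne') (Complex.exp_ne_zero _)),
      Complex.log_ofReal_mul hc (Complex.exp_ne_zero _), Complex.log_exp]
    · push_cast; rfl
    · simp; linarith
    · simp; linarith
  have k1 := key φ hφ s
  have k2 := key (-φ) (by rwa [abs_neg]) (-s)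
  rw [show ((-φ : ℝ) : ℂ) * Complex.I = -(φ * Complex.I) by push_cast; ring] at k2
  rw [k1, k2, ← Complex.exp_add, neg_div, Real.cos_neg]
  congr 1
  push_cast
  ring

section

variable (L : ℝ)

/-- The function `θ ↦ e^{izθ}` on `[0, L]`. -/
def expFun (z : ℂ) : C(Set.Icc (0 : ℝ) L, ℂ) where
  toFun θ := Complex.exp (z * (θ : ℝ) * Complex.I)
  continuous_toFun := by fun_prop

@[simp] lemma expFun_apply (z : ℂ) (θ : Set.Icc (0 : ℝ) L) :
    expFun L z θ = Complex.exp (z * (θ : ℝ) * Complex.I) := rfl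

lemma expFun_add (z w : ℂ) : expFun L (z + w) = expFun L z * expFun L w := by
  ext θ
  simp [← Complex.exp_add, add_mul]

/-- In the Banach algebra C([0, L]) this is the exponential z ↦ exp(zT) with T(θ) = iθ. -/
lemma differentiable_expFun : Differentiable ℂ (expFun L) := by
  let T : C(Set.Icc (0 : ℝ) L, ℂ) := ⟨fun θ => (θ : ℝ) * Complex.I, by fun_prop⟩
  have h : expFun L = fun z : ℂ => NormedSpace.exp (z • T) := by
    ext z θ
    have := NormedSpace.map_exp (ContinuousMap.evalAlgHom ℂ ℂ θ)
      (continuous_eval_const θ) (z • T)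
    simp only [ContinuousMap.evalAlgHom_apply] at this
    rw [this, ← Complex.exp_eq_exp_ℂ]
    simp [T, mul_assoc]
  rw [h]
  exact differentiable_exp_smul_const ℂ T

lemma norm_expFun_le {z : ℂ} (hz : 0 ≤ z.im) : ‖expFun L z‖ ≤ 1 := by
  rw [ContinuousMap.norm_le _ zero_le_one]
  intro θ
  rw [expFun_apply, Complex.norm_exp]
  simp only [Complex.mul_re, Complex.I_re, Complex.mul_im, Complex.ofReal_re, Complex.ofReal_im,
    Complex.I_im]
  rw [Real.exp_le_one_iff]
  have := mul_nonneg hz θ.2.1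
  linarith

/-- The rotated difference factor `(1 - e^{ε i (θ - L / 2)}) / 2`, `ε = ± 1`. -/
def diffFactor (ε : ℤ) : C(Set.Icc (0 : ℝ) L, ℂ) :=
  (1 / 2 : ℂ) • (1 - Complex.exp (-(ε * (L / 2) * Complex.I)) • expFun L ε)

lemma diffFactor_apply (ε : ℤ) (θ : Set.Icc (0 : ℝ) L) :
    diffFactor L ε θ = (1 - Complex.exp ((ε * (θ - L / 2) : ℝ) * Complex.I)) / 2 := by
  have h : Complex.exp ((ε * (θ - L / 2) : ℝ) * Complex.I) =
      Complex.exp (-(ε * (L / 2) * Complex.I)) * Complex.exp (ε * (θ : ℝ) * Complex.I) := by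
    rw [← Complex.exp_add]
    congr 1
    push_cast
    ring
  rw [h]
  simp only [diffFactor, ContinuousMap.smul_apply, ContinuousMap.sub_apply,
    ContinuousMap.one_apply, expFun_apply, smul_eq_mul]
  ring

/-- Centring at L/2 gives modulus |sin((θ - L/2)/2)|. The bound sin(L/4) is below 1 exactly because
L < 2π. -/
lemma norm_diffFactor_le (hL0 : 0 ≤ L) (hL : L < 2 * Real.pi) {ε : ℤ} (hε : ε = 1 ∨ ε = -1) :
    ‖diffFactor L ε‖ ≤ Real.sin (L / 4) := by
  have hs : 0 ≤ Real.sin (L / 4) := Real.sin_nonneg_of_nonneg_of_le_pi (by linarith)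
    (by linarith [Real.pi_pos])
  rw [ContinuousMap.norm_le _ hs]
  intro θ
  have hε' : |(ε : ℝ)| = 1 := by rcases hε with rfl | rfl <;> simp
  rw [diffFactor_apply, norm_div, norm_sub_rev, mul_comm _ Complex.I,
    Complex.norm_exp_I_mul_ofReal_sub_one]
  simp only [norm_mul, Real.norm_eq_abs, Complex.norm_ofNat, abs_two]
  rw [mul_div_cancel_left₀ _ two_ne_zero]
  have hb : |(ε : ℝ) * (θ - L / 2) / 2| ≤ L / 4 := by
    rw [abs_div, abs_mul, hε', one_mul, abs_two]
    have : |(θ : ℝ) - L / 2| ≤ L / 2 := abs_le.2 ⟨by linarith [θ.2.1], by linarith [θ.2.2]⟩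
    linarith
  obtain ⟨h1, h2⟩ := abs_le.1 hb
  refine abs_le.2 ⟨?_, ?_⟩
  · rw [← Real.sin_neg]
    exact Real.sin_le_sin_of_le_of_le_pi_div_two (by linarith) (by linarith) h1
  · exact Real.sin_le_sin_of_le_of_le_pi_div_two (by linarith) (by linarith) h2

variable {L}

/-- Each factor replaces a value of ψ by half the difference of values at two neighbouring
frequencies, up to a unimodular constant, so the bound does not grow. -/
lemma norm_apply_mul_diffFactor_pow_le (ψ : C(Set.Icc (0 : ℝ) L, ℂ) →L[ℂ] ℂ) {b : ℝ}
    (k l : ℕ) (n : ℤ) (hb : ∀ m : ℤ, n - l ≤ m → m ≤ n + k → ‖ψ (expFun L m)‖ ≤ b) :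
    ‖ψ (expFun L n * (diffFactor L 1 ^ k * diffFactor L (-1) ^ l))‖ ≤ b := by
  have step : ∀ (ε n : ℤ) (f : C(Set.Icc (0 : ℝ) L, ℂ)), ‖ψ (expFun L n * f)‖ ≤ b →
      ‖ψ (expFun L (n + ε : ℤ) * f)‖ ≤ b → ‖ψ (expFun L n * (diffFactor L ε * f))‖ ≤ b := by
    intro ε n f h1 h2
    have : expFun L n * (diffFactor L ε * f) = (1 / 2 : ℂ) • (expFun L n * f) -
        ((1 / 2 : ℂ) * Complex.exp (-(ε * (L / 2) * Complex.I))) • (expFun L (n + ε : ℤ) * f) := by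
      push_cast
      rw [expFun_add]
      ext θ
      simp [diffFactor]
      ring
    rw [this, map_sub, map_smul, map_smul]
    refine (norm_sub_le _ _).trans ?_
    have hn : ‖Complex.exp (-(ε * (L / 2) * Complex.I))‖ = 1 := by
      rw [show -((ε : ℂ) * (L / 2) * Complex.I) = ((-(ε * (L / 2)) : ℝ) : ℂ) * Complex.I by
        push_cast; ring, Complex.norm_exp_ofReal_mul_I]
    rw [norm_smul, norm_smul, norm_mul, hn]
    norm_num only [norm_div, norm_one, Complex.norm_ofNat]
    linarith
  induction k generalizing n with
  | succ k ih =>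
    rw [pow_succ', mul_assoc]
    refine step 1 n _ (ih n fun m h1 h2 => hb m h1 (by push_cast; omega))
      (ih (n + 1) fun m h1 h2 => hb m (by omega) (by push_cast; omega))
  | zero =>
    induction l generalizing n with
    | zero => simpa using hb n (by simp) (by simp)
    | succ l ih =>
      rw [pow_zero, one_mul] at ih ⊢
      rw [pow_succ']
      refine step (-1) n _ (ih n fun m h1 h2 => hb m (by push_cast; omega) h2)
        (ih (n + -1) fun m h1 h2 => hb m (by push_cast; omega) (by push_cast at h2 ⊢; omega))

/-- Small values of a functional at the exponentials with integer frequencies near `n` force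
small values at the intermediate frequencies. -/
lemma exists_norm_apply_expFun_le (hL0 : 0 ≤ L) (hL : L < 2 * Real.pi) :
    ∃ σ : ℝ, 0 < σ ∧ σ < 1 ∧ ∀ (ψ : C(Set.Icc (0 : ℝ) L, ℂ) →L[ℂ] ℂ) (S : ℝ) (D : ℕ) (n : ℤ)
      (s : ℝ), 0 ≤ s → s ≤ 1 →
      (∀ m : ℤ, n - D ≤ m → m ≤ n + D → ‖ψ (expFun L m)‖ ≤ S * Real.exp (-D)) →
      ‖ψ (expFun L (n + s))‖ ≤ max S ‖ψ‖ * ((1 - σ)⁻¹ * (1 - σ)⁻¹) * σ ^ D := by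
  have : Nonempty (Set.Icc (0 : ℝ) L) := ⟨⟨0, le_rfl, hL0⟩⟩
  set ρ := Real.sin (L / 4) with hρ
  have hρ0 : 0 ≤ ρ := Real.sin_nonneg_of_nonneg_of_le_pi (by linarith) (by linarith [Real.pi_pos])
  have hρ1 : ρ < 1 := by
    rw [hρ, ← Real.sin_pi_div_two]
    exact Real.sin_lt_sin_of_lt_of_le_pi_div_two (by linarith [Real.pi_pos]) le_rfl (by linarith)
  -- Chosen so that ρ ≤ σ² and e^{-1} ≤ σ⁴: both kinds of terms of the double series below are then
  -- at most a constant times σ^{D+k+l}.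
  set σ := max (Real.sqrt ρ) (Real.exp (-(1 / 4))) with hσ
  have hσ0 : 0 < σ := (Real.exp_pos _).trans_le (le_max_right _ _)
  have hσ1 : σ < 1 := max_lt (by rw [Real.sqrt_lt' one_pos]; simpa using hρ1) (by simp)
  have hρσ : ρ ≤ σ ^ 2 := by
    rw [← Real.sq_sqrt hρ0]
    exact pow_le_pow_left₀ (Real.sqrt_nonneg _) (le_max_left _ _) 2
  have heσ : Real.exp (-1) ≤ σ ^ 4 := by
    have : Real.exp (-1) = Real.exp (-(1 / 4)) ^ 4 := by
      rw [← Real.exp_nat_mul]; norm_num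
    rw [this]
    exact pow_le_pow_left₀ (Real.exp_pos _).le (le_max_right _ _) 4
  refine ⟨σ, hσ0, hσ1, fun ψ S D n s hs0 hs1 hb => ?_⟩
  set u := diffFactor L 1 with hu
  set v := diffFactor L (-1) with hv
  have hun : ‖u‖ ≤ ρ := norm_diffFactor_le L hL0 hL (Or.inl rfl)
  have hvn : ‖v‖ ≤ ρ := norm_diffFactor_le L hL0 hL (Or.inr rfl)
  have hsum : ∀ (w : C(Set.Icc (0 : ℝ) L, ℂ)) (t : ℝ), ‖w‖ ≤ ρ → |t| ≤ 1 →
      Summable fun k : ℕ => ‖((-1) ^ k * Ring.choose (t : ℂ) k) • w ^ k‖ := by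
    intro w t hw ht
    refine Summable.of_nonneg_of_le (fun _ => norm_nonneg _) (fun k => ?_)
      (summable_geometric_of_lt_one hρ0 hρ1)
    calc _ ≤ ‖(-1) ^ k * Ring.choose (t : ℂ) k‖ * ‖w ^ k‖ := norm_smul_le _ _
      _ ≤ 1 * ρ ^ k := by
        refine mul_le_mul (norm_neg_one_pow_mul_choose_le_one ht k) ?_ (norm_nonneg _) zero_le_one
        refine (norm_pow_le _ _).trans ?_
        exact pow_le_pow_left₀ (norm_nonneg _) hw k
      _ = ρ ^ k := one_mul _
  have heval : ∀ (w : C(Set.Icc (0 : ℝ) L, ℂ)) (t : ℝ), ‖w‖ ≤ ρ → |t| ≤ 1 → ∀ θ,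
      (∑' k : ℕ, ((-1) ^ k * Ring.choose (t : ℂ) k) • w ^ k) θ = (1 - w θ) ^ (t : ℂ) := by
    intro w t hw ht θ
    have h1 := (hsum w t hw ht).of_norm.hasSum.map
      (ContinuousMap.evalAlgHom ℂ ℂ θ) (continuous_eval_const θ)
    simp only [ContinuousMap.evalAlgHom_apply] at h1
    refine h1.unique ?_
    refine (hasSum_one_sub_cpow (t : ℂ)
      ((w.norm_coe_le_norm θ).trans_lt (hw.trans_lt hρ1))).congr_fun fun k => ?_
    simp
  have hs : |s| ≤ 1 := abs_le.2 ⟨by linarith, hs1⟩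
  have hs' : |(-s)| ≤ 1 := by rwa [abs_neg]
  -- Up to a unimodular constant, e^{i(n+s)θ} = e^{inθ}(1 - u)^s(1 - v)^{-s}, with both powers
  -- expanded in binomial series.
  have hfac : expFun L (n + s) = Complex.exp (s * (L / 2) * Complex.I) • (expFun L n *
      ((∑' k : ℕ, ((-1) ^ k * Ring.choose (s : ℂ) k) • u ^ k) *
        ∑' l : ℕ, ((-1) ^ l * Ring.choose ((-s : ℝ) : ℂ) l) • v ^ l)) := by
    ext θ
    rw [ContinuousMap.smul_apply, ContinuousMap.mul_apply, ContinuousMap.mul_apply,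
      heval u s hun hs, heval v (-s) hvn hs', hu, hv, diffFactor_apply, diffFactor_apply]
    have hφ : |(θ : ℝ) - L / 2| < Real.pi :=
      abs_lt.2 ⟨by linarith [θ.2.1], by linarith [θ.2.2]⟩
    have := half_one_add_exp_cpow_mul (s := s) hφ
    rw [show (((1 : ℤ) * ((θ : ℝ) - L / 2) : ℝ) : ℂ) * Complex.I
        = ((θ : ℝ) - L / 2 : ℝ) * Complex.I by push_cast; ring,
      show ((((-1 : ℤ) : ℝ) * ((θ : ℝ) - L / 2) : ℝ) : ℂ) * Complex.I
        = -(((θ : ℝ) - L / 2 : ℝ) * Complex.I) by push_cast; ring, this,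
      expFun_apply, expFun_apply, smul_eq_mul, ← Complex.exp_add, ← Complex.exp_add]
    congr 1
    push_cast
    ring
  have hn1 : ‖Complex.exp (s * (L / 2) * Complex.I)‖ = 1 := by
    rw [show (s : ℂ) * (L / 2) * Complex.I = ((s * (L / 2) : ℝ) : ℂ) * Complex.I by
      push_cast; ring, Complex.norm_exp_ofReal_mul_I]
  rw [hfac, map_smul, norm_smul, hn1, one_mul,
    tsum_mul_tsum_of_summable_norm (hsum u s hun hs) (hsum v (-s) hvn hs')]
  set Ψ : C(Set.Icc (0 : ℝ) L, ℂ) →L[ℂ] ℂ :=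
    ψ.comp (ContinuousLinearMap.mul ℂ C(Set.Icc (0 : ℝ) L, ℂ) (expFun L n)) with hΨ
  have hΨa : ∀ f, ψ (expFun L n * f) = Ψ f := fun f => rfl
  rw [hΨa, Ψ.map_tsum (summable_mul_of_summable_norm (hsum u s hun hs) (hsum v (-s) hvn hs'))]
  have hgeo := hasSum_geometric_of_lt_one hσ0.le hσ1
  have hgeo2 := (hgeo.mul hgeo (summable_mul_of_summable_norm hgeo.summable.norm
    hgeo.summable.norm)).mul_left (max S ‖ψ‖ * σ ^ D)
  have hmax0 : 0 ≤ max S ‖ψ‖ := (norm_nonneg ψ).trans (le_max_right _ _)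
  rw [mul_right_comm]
  refine tsum_of_norm_bounded hgeo2 ?_
  rintro ⟨k, l⟩
  simp only
  rw [smul_mul_smul_comm, map_smul, norm_smul, norm_mul]
  have hc : ‖(-1) ^ k * Ring.choose (s : ℂ) k‖ *
      ‖(-1) ^ l * Ring.choose ((-s : ℝ) : ℂ) l‖ ≤ 1 :=
    mul_le_one₀ (norm_neg_one_pow_mul_choose_le_one hs k) (norm_nonneg _)
      (norm_neg_one_pow_mul_choose_le_one hs' l)
  refine (mul_le_of_le_one_left (norm_nonneg _) hc).trans ?_
  rw [← hΨa]
  -- When k, l ≤ D only frequencies within D of n occur and the decay of ψ applies. Otherwise k + l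
  -- > D and the smallness of u^k v^l suffices.
  by_cases hkl : k ≤ D ∧ l ≤ D
  · have hS : 0 ≤ S * Real.exp (-D) := (norm_nonneg _).trans (hb n (by omega) (by omega))
    have hb' := norm_apply_mul_diffFactor_pow_le ψ k l n
      (fun m h1 h2 => hb m (by omega) (by omega))
    refine hb'.trans ?_
    calc S * Real.exp (-D) ≤ max S ‖ψ‖ * (σ ^ 4) ^ D := by
          refine mul_le_mul (le_max_left _ _) ?_ (Real.exp_pos _).le hmax0
          have : Real.exp (-D) = Real.exp (-1) ^ D := by rw [← Real.exp_nat_mul]; simp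
          rw [this]
          exact pow_le_pow_left₀ (Real.exp_pos _).le heσ D
      _ ≤ max S ‖ψ‖ * σ ^ (D + (k + l)) := by
          rw [← pow_mul]
          exact mul_le_mul_of_nonneg_left
            (pow_le_pow_of_le_one hσ0.le hσ1.le (by omega)) hmax0
      _ = _ := by rw [pow_add, pow_add, mul_assoc]
  · calc ‖ψ (expFun L n * (u ^ k * v ^ l))‖ ≤ ‖ψ‖ * (1 * (ρ ^ k * ρ ^ l)) := by
          refine (ψ.le_opNorm _).trans ?_
          gcongr
          refine (norm_mul_le _ _).trans ?_
          refine mul_le_mul (norm_expFun_le L (by simp)) ?_ (norm_nonneg _) zero_le_one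
          refine (norm_mul_le _ _).trans ?_
          gcongr
          · exact (norm_pow_le _ _).trans (pow_le_pow_left₀ (norm_nonneg _) hun k)
          · exact (norm_pow_le _ _).trans (pow_le_pow_left₀ (norm_nonneg _) hvn l)
      _ ≤ max S ‖ψ‖ * σ ^ (D + (k + l)) := by
          refine mul_le_mul (le_max_right _ _) ?_ (by positivity) hmax0
          rw [one_mul, ← pow_add]
          calc ρ ^ (k + l) ≤ (σ ^ 2) ^ (k + l) := pow_le_pow_left₀ hρ0 hρσ _
            _ ≤ σ ^ (D + (k + l)) := by
              rw [← pow_mul]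
              exact pow_le_pow_of_le_one hσ0.le hσ1.le (by omega)
      _ = _ := by rw [pow_add, pow_add, mul_assoc]

end

/-! ### Dyadic form of the divergence condition -/

lemma summable_of_summable_dyadic_blocks {f : ℕ → ℝ} (hf : ∀ n, 0 ≤ f n)
    (hs : Summable fun i : ℕ => ∑ k ∈ Finset.range (2 ^ i), f (2 ^ i + k)) : Summable f := by
  have h : ∀ J : ℕ, ∑ n ∈ Finset.range (2 ^ J), f n =
      f 0 + ∑ i ∈ Finset.range J, ∑ k ∈ Finset.range (2 ^ i), f (2 ^ i + k) := by
    intro J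
    induction J with
    | zero => simp
    | succ J ih => rw [pow_succ, mul_two, Finset.sum_range_add, ih, Finset.sum_range_succ, add_assoc]
  refine summable_of_sum_range_le
    (c := f 0 + ∑' i : ℕ, ∑ k ∈ Finset.range (2 ^ i), f (2 ^ i + k)) hf fun n => ?_
  calc ∑ i ∈ Finset.range n, f i ≤ ∑ i ∈ Finset.range (2 ^ n), f i :=
        Finset.sum_le_sum_of_subset_of_nonneg
          (Finset.range_mono Nat.lt_two_pow_self.le) fun i _ _ => hf i
    _ ≤ _ := by
      rw [h]
      gcongr
      exact hs.sum_le_tsum _ fun i _ => Finset.sum_nonneg fun k _ => hf _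

lemma ClassXPlus.exists_monotone {c : ℕ → ℝ} (hc : ClassXPlus c) :
    ∃ N : ℕ, ∀ m n, N ≤ m → m ≤ n → c m ≤ c n := by
  obtain ⟨N, hN⟩ := eventually_atTop.1
    ((hc.tendsto_growth.eventually_ge_atTop 0).and (eventually_gt_atTop 0))
  refine ⟨N, fun m n hm hmn => ?_⟩
  induction n, hmn using Nat.le_induction with
  | base => rfl
  | succ n hn ih =>
    obtain ⟨h1, h2⟩ := hN n (hm.trans hn)
    have h2' : (0 : ℝ) < n := by exact_mod_cast h2
    have := nonneg_of_mul_nonneg_right h1 h2'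
    linarith

/-- Cauchy condensation, using that c is eventually monotone. The cap and the floor are harmless:
rounding costs at most a geometric series, and convergence would make the terms tend to 0, so that
the cap 2^i is eventually inactive. -/
lemma ClassXPlus.not_summable_dyadic {c : ℕ → ℝ} (hc : ClassXPlus c) :
    ¬ Summable fun i : ℕ => ((⌊min (c (2 ^ i)) (2 ^ i)⌋₊ : ℕ) : ℝ) / 2 ^ i := by
  intro hs
  obtain ⟨N, hN⟩ := hc.exists_monotone
  have h1 : Summable fun i : ℕ => min (c (2 ^ i)) (2 ^ i) / 2 ^ i := by
    refine Summable.of_nonneg_of_le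
      (fun i => div_nonneg (le_min (hc.pos _).le (by positivity)) (by positivity))
      (fun i => ?_) (hs.add summable_geometric_two)
    rw [one_div, inv_pow, ← one_div, ← add_div]
    gcongr
    exact (Nat.lt_floor_add_one _).le
  have h2 : Summable fun i : ℕ => c (2 ^ i) / 2 ^ i := by
    obtain ⟨I, hI⟩ := eventually_atTop.1 (h1.tendsto_atTop_zero.eventually_lt_const one_pos)
    rw [← summable_nat_add_iff I] at h1 ⊢
    refine h1.congr fun i => ?_
    have h3 := hI (i + I) (by omega)
    rw [div_lt_one (by positivity), min_lt_iff] at h3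
    rw [min_eq_left (h3.resolve_right (lt_irrefl _)).le]
  refine hc.diverges (summable_of_summable_dyadic_blocks
    (fun n => div_nonneg (hc.pos n).le (by positivity)) ?_)
  rw [← summable_nat_add_iff N]
  refine Summable.of_nonneg_of_le (fun i => Finset.sum_nonneg fun k _ =>
    div_nonneg (hc.pos _).le (by positivity)) (fun i => ?_)
    (((summable_nat_add_iff (N + 1)).2 h2).mul_left 2)
  have hNi : N ≤ 2 ^ (i + N) := Nat.lt_two_pow_self.le.trans (Nat.pow_le_pow_right (by omega) (by omega))
  calc ∑ k ∈ Finset.range (2 ^ (i + N)), c (2 ^ (i + N) + k) / (((2 ^ (i + N) + k : ℕ) : ℝ) ^ 2 + 1)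
      ≤ ∑ k ∈ Finset.range (2 ^ (i + N)), c (2 ^ (i + (N + 1))) / (2 ^ (i + N)) ^ 2 := by
        refine Finset.sum_le_sum fun k hk => ?_
        have hk' := Finset.mem_range.1 hk
        refine div_le_div₀ (hc.pos _).le (hN _ _ (by omega) ?_) (by positivity) ?_
        · rw [← add_assoc, pow_succ]; omega
        · push_cast
          have : (0 : ℝ) ≤ k := by positivity
          have h5 : (0 : ℝ) < 2 ^ (i + N) := by positivity
          nlinarith
    _ = 2 * (c (2 ^ (i + (N + 1))) / 2 ^ (i + (N + 1))) := by
        rw [Finset.sum_const, Finset.card_range, nsmul_eq_mul, ← add_assoc i N 1, pow_succ (2 : ℝ)]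
        push_cast
        field_simp

/-! ### Duality and density of admissible polynomials -/

/-- A functional on `C([0, L])`, `L < 2π`, whose values at `e^{inθ}` decay like `e^{-c_n}`
as `n → +∞` vanishes at all the exponentials. -/
lemma apply_expFun_eq_zero {c : ℕ → ℝ} (hc : ClassXPlus c) {L : ℝ} (hL0 : 0 ≤ L)
    (hL : L < 2 * Real.pi) (ψ : C(Set.Icc (0 : ℝ) L, ℂ) →L[ℂ] ℂ) {S : ℝ} {N : ℕ}
    (hψ : ∀ n : ℕ, N < n → ‖ψ (expFun L n)‖ ≤ S * Real.exp (-c n)) (z : ℂ) (hz : 0 ≤ z.im) :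
    ψ (expFun L z) = 0 := by
  obtain ⟨σ, hσ0, hσ1, hσ⟩ := exists_norm_apply_expFun_le hL0 hL
  obtain ⟨N₁, hN₁⟩ := hc.exists_monotone
  have hS : 0 ≤ S := nonneg_of_mul_nonneg_left ((norm_nonneg _).trans (hψ (N + 1) (by omega)))
    (Real.exp_pos _)
  have hdiff : Differentiable ℂ fun z => ψ (expFun L z) :=
    ψ.differentiable.comp (differentiable_expFun L)
  have hupper : ∀ ζ : ℂ, 0 < ζ.im → ψ (expFun L ζ) = 0 := by
    intro ζ hζ
    refine eq_zero_of_bounded_of_decay hdiff (M := ‖ψ‖)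
      (C := max S ‖ψ‖ * ((1 - σ)⁻¹ * (1 - σ)⁻¹)) (i₀ := N + N₁ + 1) ?_ hσ0 hσ1 ?_
      hc.not_summable_dyadic hζ
    · intro w hw
      exact (ψ.le_opNorm _).trans (mul_le_of_le_one_right (norm_nonneg _) (norm_expFun_le L hw))
    · intro i hi x hx
      -- The cap 2^i keeps the window of radius D about ⌊x⌋ ≥ 2^{i+1} inside [2^i, ∞), where c is at
      -- least c(2^i) ≥ D.
      set D := ⌊min (c (2 ^ i)) (2 ^ i)⌋₊ with hD
      have hDm : (D : ℝ) ≤ min (c (2 ^ i)) (2 ^ i) :=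
        Nat.floor_le (le_min (hc.pos _).le (by positivity))
      have hDc : (D : ℝ) ≤ c (2 ^ i) := hDm.trans (min_le_left _ _)
      have hD2 : (D : ℤ) ≤ 2 ^ i := by exact_mod_cast hDm.trans (min_le_right _ _)
      have hn : (2 : ℤ) ^ (i + 1) ≤ ⌊x⌋ := Int.le_floor.2 (by exact_mod_cast hx)
      have hi2 : (i : ℤ) < 2 ^ i := by exact_mod_cast Nat.lt_two_pow_self (n := i)
      have hfr : (⌊x⌋ : ℂ) + (Int.fract x : ℝ) = x := by
        rw [← Complex.ofReal_intCast, ← Complex.ofReal_add, Int.floor_add_fract]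
      have := hσ ψ S D ⌊x⌋ (Int.fract x) (Int.fract_nonneg x) (Int.fract_lt_one x).le ?_
      · rwa [hfr] at this
      · intro m hm1 hm2
        rw [pow_succ] at hn
        obtain ⟨k, rfl⟩ := Int.eq_ofNat_of_zero_le (show 0 ≤ m by omega)
        have hk : 2 ^ i ≤ k := by
          have : ((2 ^ i : ℕ) : ℤ) ≤ k := by push_cast; omega
          exact_mod_cast this
        have hk' : i < k := Nat.lt_two_pow_self.trans_le hk
        refine (hψ k (by omega)).trans ?_
        gcongr
        refine hDc.trans (hN₁ _ _ ?_ hk)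
        exact le_trans (by omega) (Nat.lt_two_pow_self (n := i)).le
  -- Continuity carries the vanishing to the real axis, and so to the negative integers, about which
  -- the decay assumption says nothing.
  have hcl : IsClosed {z : ℂ | ψ (expFun L z) = 0} := isClosed_eq hdiff.continuous continuous_const
  have : closure {z : ℂ | 0 < z.im} ⊆ {z : ℂ | ψ (expFun L z) = 0} :=
    hcl.closure_subset_iff.2 hupper
  rw [Complex.closure_setOfPred_lt_im] at this
  exact this hz

/-- The pull-back to `[0, L]` of a continuous function on the circle. -/
def pullback (L : ℝ) (g : C(Circle, ℂ)) : C(Set.Icc (0 : ℝ) L, ℂ) :=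
  ⟨fun θ => g (Circle.exp θ), by fun_prop⟩

/-- Trigonometric polynomials are dense in C(𝕋), and the kernel of ψ after pull-back is closed. -/
lemma apply_pullback_eq_zero {L : ℝ} (ψ : C(Set.Icc (0 : ℝ) L, ℂ) →L[ℂ] ℂ)
    (hψ : ∀ n : ℤ, ψ (expFun L n) = 0) (g : C(Circle, ℂ)) : ψ (pullback L g) = 0 := by
  have : Fact (0 < 2 * Real.pi) := ⟨Real.two_pi_pos⟩
  let ι : C(Set.Icc (0 : ℝ) L, AddCircle (2 * Real.pi)) :=
    ⟨fun θ => ((θ : ℝ) : AddCircle (2 * Real.pi)), by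
      exact (AddCircle.continuous_mk' _).comp continuous_subtype_val⟩
  let R : C(AddCircle (2 * Real.pi), ℂ) →ₗ[ℂ] ℂ :=
    ψ.toLinearMap ∘ₗ (ContinuousMap.compRightAlgHom ℂ ℂ ι).toLinearMap
  have hRa : ∀ f, R f = ψ (f.comp ι) := fun f => rfl
  have hRc : Continuous R := ψ.continuous.comp (ContinuousMap.continuous_precomp ι)
  have hspan : Submodule.span ℂ (Set.range (fourier (T := 2 * Real.pi))) ≤ LinearMap.ker R := by
    rw [Submodule.span_le]
    rintro _ ⟨n, rfl⟩
    rw [SetLike.mem_coe, LinearMap.mem_ker, hRa, ← hψ n]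
    congr 1
    ext θ
    rw [ContinuousMap.comp_apply, expFun_apply]
    change fourier n ((θ : ℝ) : AddCircle (2 * Real.pi)) = _
    rw [fourier_coe_apply]
    congr 1
    have : (Real.pi : ℂ) ≠ 0 := by exact_mod_cast Real.pi_ne_zero
    push_cast
    field_simp
  have htop := Submodule.topologicalClosure_minimal _ hspan
    (isClosed_singleton.preimage hRc)
  rw [span_fourier_closure_eq_top] at htop
  have h := htop
    (Submodule.mem_top (x := g.comp ⟨AddCircle.toCircle, AddCircle.continuous_toCircle⟩))
  rw [LinearMap.mem_ker, hRa] at h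
  rw [← h]
  congr 1
  ext θ
  change g (Circle.exp θ) = g (AddCircle.toCircle ((θ : ℝ) : AddCircle (2 * Real.pi)))
  rw [AddCircle.toCircle_apply_mk, div_self Real.two_pi_pos.ne', one_mul]

/-- Polynomials without terms of degree at most `N` and with coefficients bounded by `e^{c_n}`. -/
def admissible (c : ℕ → ℝ) (N : ℕ) : Set (Polynomial ℂ) :=
  {p | (∀ n ≤ N, p.coeff n = 0) ∧ ∀ n, ‖p.coeff n‖ ≤ Real.exp (c n)}

lemma convex_admissible (c : ℕ → ℝ) (N : ℕ) : Convex ℝ (admissible c N) := by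
  rintro p ⟨hp1, hp2⟩ q ⟨hq1, hq2⟩ a b ha hb hab
  refine ⟨fun n hn => by simp [hp1 n hn, hq1 n hn], fun n => ?_⟩
  rw [Polynomial.coeff_add, Polynomial.coeff_smul, Polynomial.coeff_smul]
  refine (norm_add_le _ _).trans ?_
  rw [norm_smul, norm_smul, Real.norm_of_nonneg ha, Real.norm_of_nonneg hb]
  calc _ ≤ a * Real.exp (c n) + b * Real.exp (c n) := by gcongr; exacts [hp2 n, hq2 n]
    _ = _ := by rw [← add_mul, hab, one_mul]

/-- Admissible polynomials are uniformly dense on every arc `J_k`. -/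
theorem exists_admissible_approx {c : ℕ → ℝ} (hc : ClassXPlus c) (k : ℕ+) (N : ℕ)
    (g : C(Circle, ℂ)) {ε : ℝ} (hε : 0 < ε) :
    ∃ p ∈ admissible c N, ∀ z ∈ arc k, ‖p.eval (z : ℂ) - g z‖ < ε := by
  set L := 2 * Real.pi - 1 / ((k : ℕ) : ℝ) with hLdef
  have hk : (1 : ℝ) ≤ (k : ℕ) := by exact_mod_cast k.pos
  have hk1 : 1 / ((k : ℕ) : ℝ) ≤ 1 := (div_le_one (by positivity)).2 hk
  have hk0 : 0 < 1 / ((k : ℕ) : ℝ) := by positivity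
  have hL0 : 0 ≤ L := by linarith [Real.pi_gt_three]
  have hL : L < 2 * Real.pi := by linarith
  set Λ : Polynomial ℂ →ₗ[ℂ] C(Set.Icc (0 : ℝ) L, ℂ) :=
    (Polynomial.aeval (expFun L 1)).toLinearMap with hΛ
  have hΛa : ∀ p θ, Λ p θ = p.eval (Circle.exp (θ : ℝ) : ℂ) := by
    intro p θ
    have := Polynomial.aeval_algHom_apply (ContinuousMap.evalAlgHom ℂ ℂ θ) (expFun L 1) p
    simp only [ContinuousMap.evalAlgHom_apply, expFun_apply, one_mul] at this
    simp only [hΛ, AlgHom.toLinearMap_apply, ← this, Polynomial.coe_aeval_eq_eval, Circle.coe_exp]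
  set K := (Λ.restrictScalars ℝ) '' admissible c N with hK
  have hKconv : Convex ℝ (closure K) :=
    ((convex_admissible c N).linear_image (Λ.restrictScalars ℝ)).closure
  have hmem : pullback L g ∈ closure K := by
    by_contra hnot
    obtain ⟨ψ, u, hψK, hψg⟩ :=
      RCLike.geometric_hahn_banach_closed_point (𝕜 := ℂ) hKconv isClosed_closure hnot
    have hψ' : ∀ p ∈ admissible c N, (ψ (Λ p)).re < u := fun p hp =>
      hψK _ (subset_closure ⟨p, hp, rfl⟩)
    -- The zero polynomial is admissible.
    have hu : 0 < u := by
      have := hψ' 0 ⟨by simp, by simp [Real.exp_nonneg]⟩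
      simpa using this
    have hdecay : ∀ n : ℕ, N < n → ‖ψ (expFun L n)‖ ≤ u * Real.exp (-c n) := by
      intro n hn
      rcases eq_or_ne (ψ (expFun L n)) 0 with h0 | h0
      · rw [h0, norm_zero]; positivity
      set b := ψ (expFun L n) with hb
      have hb0 : (‖b‖ : ℂ) ≠ 0 := by exact_mod_cast norm_ne_zero_iff.2 h0
      -- Test on the largest admissible monomial, with the phase that makes its value under ψ equal
      -- to |b| e^{c_n}.
      have hp := hψ' (Polynomial.monomial n ((starRingEnd ℂ) b / ‖b‖ * Real.exp (c n))) ?_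
      · have : Λ (Polynomial.monomial n ((starRingEnd ℂ) b / ‖b‖ * Real.exp (c n))) =
            ((starRingEnd ℂ) b / ‖b‖ * Real.exp (c n)) • expFun L n := by
          ext θ
          rw [hΛa, Polynomial.eval_monomial, ContinuousMap.smul_apply, expFun_apply, smul_eq_mul,
            Circle.coe_exp, ← Complex.exp_nat_mul, mul_assoc (n : ℂ)]
        rw [this, map_smul, smul_eq_mul, ← hb] at hp
        have e : (starRingEnd ℂ) b / ‖b‖ * Real.exp (c n) * b = ((‖b‖ * Real.exp (c n) : ℝ) : ℂ) := by
          have := Complex.conj_mul' b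
          rw [div_mul_eq_mul_div, div_mul_eq_mul_div, div_eq_iff hb0]
          push_cast
          linear_combination (Complex.exp (c n)) * this
        rw [e, Complex.ofReal_re] at hp
        rw [Real.exp_neg, ← div_eq_mul_inv, le_div_iff₀ (Real.exp_pos _)]
        exact hp.le
      · refine ⟨fun m hm => ?_, fun m => ?_⟩
        · rw [Polynomial.coeff_monomial, if_neg (by omega)]
        · rw [Polynomial.coeff_monomial]
          split_ifs with h
          · subst h
            rw [norm_mul, norm_div, Complex.norm_conj, Complex.norm_real, norm_norm,
              div_self (norm_ne_zero_iff.2 h0), one_mul, Complex.norm_real,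
              Real.norm_of_nonneg (Real.exp_nonneg _)]
          · simp [Real.exp_nonneg]
    have hz := apply_pullback_eq_zero ψ (fun n => apply_expFun_eq_zero hc hL0 hL ψ hdecay n (by simp)) g
    rw [hz] at hψg
    simp at hψg
    linarith
  obtain ⟨_, ⟨p, hp, rfl⟩, hpε⟩ := Metric.mem_closure_iff.1 hmem ε hε
  refine ⟨p, hp, ?_⟩
  rintro _ ⟨t, ht, rfl⟩
  rw [dist_comm, dist_eq_norm] at hpε
  refine lt_of_le_of_lt ?_ hpε
  have := (Λ p - pullback L g).norm_coe_le_norm ⟨t, ht⟩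
  rw [ContinuousMap.sub_apply, hΛa] at this
  exact this

/-! ### The topology τ -/

lemma metrizableSpace_of_withSeminorms {E ι : Type*} [AddCommGroup E] [Module ℂ E]
    [TopologicalSpace E] [Countable ι] {p : SeminormFamily ℂ E ι} (hp : WithSeminorms p)
    (hsep : ∀ x, x ≠ 0 → ∃ i, p i x ≠ 0) : TopologicalSpace.MetrizableSpace E := by
  have := hp.firstCountableTopology
  have := hp.topologicalAddGroup
  have := hp.T1_of_separating hsep
  let _ : UniformSpace E := IsTopologicalAddGroup.rightUniformSpace E
  have : IsUniformAddGroup E := isUniformAddGroup_of_addCommGroup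
  have : (uniformity E).IsCountablyGenerated := IsUniformAddGroup.uniformity_countably_generated
  exact UniformSpace.metrizableSpace

lemma withSeminorms_arcSeminorm :
    @WithSeminorms ℂ C(Circle, ℂ) ℕ+ _ _ _ (arcSeminorm : SeminormFamily ℂ C(Circle, ℂ) ℕ+)
      tauTopology :=
  @WithSeminorms.mk ℂ C(Circle, ℂ) ℕ+ _ _ _ _ tauTopology rfl

/-- The arcs exhaust the circle, which makes τ separated and finer than pointwise convergence. -/
lemma exists_mem_arc (z : Circle) : ∃ k, z ∈ arc k := by
  obtain ⟨t, ht, h⟩ := Circle.periodic_exp.exists_mem_Ico₀ Real.two_pi_pos (Complex.arg z)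
  rw [Circle.exp_arg] at h
  obtain ⟨k, hk⟩ := exists_nat_one_div_lt (sub_pos.2 ht.2)
  refine ⟨k.succPNat, t, ⟨ht.1, ?_⟩, h.symm⟩
  rw [Nat.succPNat_coe, Nat.cast_succ]
  linarith

lemma arc_mono {k l : ℕ+} (h : k ≤ l) : arc k ⊆ arc l := by
  refine Set.image_mono (Set.Icc_subset_Icc_right ?_)
  have : ((k : ℕ) : ℝ) ≤ (l : ℕ) := by exact_mod_cast h
  have hk : (0 : ℝ) < (k : ℕ) := by exact_mod_cast k.pos
  gcongr

lemma norm_apply_le_arcSeminorm {k : ℕ+} {z : Circle} (hz : z ∈ arc k) (f : C(Circle, ℂ)) :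
    ‖f z‖ ≤ arcSeminorm k f :=
  le_ciSup (bddAbove_arc k f) ⟨z, hz⟩

lemma arcSeminorm_le {k : ℕ+} {f : C(Circle, ℂ)} {C : ℝ} (hC : 0 ≤ C)
    (h : ∀ z ∈ arc k, ‖f z‖ ≤ C) : arcSeminorm k f ≤ C :=
  Real.iSup_le (fun z => h z z.2) hC

lemma tendsto_tau_iff {α : Type*} {l : Filter α} {u : α → C(Circle, ℂ)} {y : C(Circle, ℂ)} :
    Tendsto u l (@nhds _ tauTopology y) ↔
      ∀ k : ℕ+, ∀ ε > 0, ∀ᶠ n in l, arcSeminorm k (u n - y) < ε :=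
  @WithSeminorms.tendsto_nhds ℂ C(Circle, ℂ) α ℕ+ _ _ _ tauTopology arcSeminorm
    withSeminorms_arcSeminorm u l y

lemma tendsto_pointwise_iff {α : Type*} {l : Filter α} {u : α → C(Circle, ℂ)} {y : C(Circle, ℂ)} :
    Tendsto u l (@nhds _ pointwiseTopology y) ↔ ∀ z, Tendsto (fun n => u n z) l (𝓝 (y z)) := by
  rw [nhds_induced, tendsto_comap_iff, tendsto_pi_nhds]
  rfl

lemma metrizableSpace_tau : @TopologicalSpace.MetrizableSpace C(Circle, ℂ) tauTopology := by
  refine @metrizableSpace_of_withSeminorms C(Circle, ℂ) ℕ+ _ _ tauTopology _ arcSeminorm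
    withSeminorms_arcSeminorm fun f hf => ?_
  obtain ⟨z, hz⟩ := DFunLike.ne_iff.1 hf
  obtain ⟨k, hk⟩ := exists_mem_arc z
  exact ⟨k, ((norm_pos_iff.2 hz).trans_le (norm_apply_le_arcSeminorm hk f)).ne'⟩

lemma tau_le_pointwise : tauTopology ≤ pointwiseTopology := by
  refine (le_iff_nhds _ _).2 fun y => ?_
  refine tendsto_pointwise_iff.2 fun z => Metric.tendsto_nhds.2 fun ε hε => ?_
  obtain ⟨k, hk⟩ := exists_mem_arc z
  filter_upwards [tendsto_tau_iff.1 tendsto_id k ε hε] with f hf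
  rw [dist_eq_norm]
  exact (norm_apply_le_arcSeminorm hk (f - y)).trans_lt hf

/-! ### Gluing and universality -/

/-- The bilateral coefficient sequence with the given nonnegative part. -/
def extendByZero (A : ℕ → ℂ) : ℤ → ℂ
  | Int.ofNat n => A n
  | Int.negSucc _ => 0

lemma partialSum_extendByZero (A : ℕ → ℂ) (m : ℕ) (z : Circle) :
    partialSum (extendByZero A) m z = ∑ n ∈ Finset.range (m + 1), A n * (z : ℂ) ^ n := by
  symm
  refine Finset.sum_of_injOn (fun n : ℕ => (n : ℤ)) (fun _ _ _ _ h => by simpa using h) ?_ ?_ ?_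
  · intro n hn
    have := Finset.mem_range.1 hn
    simp only [Finset.coe_Icc, Set.mem_Icc]
    omega
  · intro i hi hni
    cases i with
    | ofNat n =>
      refine absurd ⟨n, ?_, rfl⟩ hni
      have := (Finset.mem_Icc.1 hi).2
      simp only [Int.ofNat_eq_natCast] at this
      simp only [Finset.coe_range, Set.mem_Iio]
      omega
    | negSucc n => simp [extendByZero]
  · intro n _
    simp [show extendByZero A (n : ℤ) = A n from rfl]

lemma sum_smul_monomial_apply (a : ℤ → ℂ) (m : ℕ) (z : Circle) :
    (∑ j ∈ Finset.Icc (-(m : ℤ)) (m : ℤ), a j • monomial j) z = partialSum a m z := by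
  rw [ContinuousMap.sum_apply]
  rfl

/-- Gluing of admissible blocks: partial sums of one series approximate all the given functions. -/
lemma exists_coeffs_approx {c : ℕ → ℝ} (hc : ClassXPlus c) (g : ℕ → C(Circle, ℂ)) :
    ∃ (A : ℕ → ℂ) (m : ℕ → ℕ), (∀ n, ‖A n‖ ≤ Real.exp (c n)) ∧ StrictMono m ∧ (∀ j, 0 < m j) ∧
      ∀ j : ℕ, ∀ z ∈ arc j.succPNat,
        ‖∑ n ∈ Finset.range (m j + 1), A n * (z : ℂ) ^ n - g j z‖ < 1 / ((j : ℝ) + 1) := by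
  have hstep : ∀ (j : ℕ) (s : Polynomial ℂ × ℕ), ∃ q ∈ admissible c s.2, ∀ z ∈ arc j.succPNat,
      ‖(s.1 + q).eval (z : ℂ) - g j z‖ < 1 / ((j : ℝ) + 1) := by
    intro j s
    have hcont : Continuous fun z : Circle => s.1.eval (z : ℂ) :=
      s.1.continuous.comp continuous_subtype_val
    obtain ⟨q, hq, h⟩ := exists_admissible_approx hc j.succPNat s.2 (g j - ⟨_, hcont⟩)
      (ε := 1 / ((j : ℝ) + 1)) (by positivity)
    refine ⟨q, hq, fun z hz => ?_⟩
    have hz' := h z hz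
    rw [ContinuousMap.sub_apply, ContinuousMap.coe_mk] at hz'
    rwa [Polynomial.eval_add, add_comm (s.1.eval _), ← sub_sub_eq_add_sub]
  choose q hqa hqb using hstep
  -- The state is the sum so far and a cutoff bounding its degree; the next block lives above the
  -- cutoff. Taking at least the old cutoff plus 1 makes cutoffs strictly increase even if a block
  -- is zero.
  set st : ℕ → Polynomial ℂ × ℕ := fun j => Nat.rec (0, 0)
    (fun j s => (s.1 + q j s, max (s.2 + 1) (s.1 + q j s).natDegree)) j with hst
  have hs : ∀ j, st (j + 1) = ((st j).1 + q j (st j),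
    max ((st j).2 + 1) ((st j).1 + q j (st j)).natDegree) := fun j => rfl
  have hdeg : ∀ j, (st j).1.natDegree ≤ (st j).2 := by
    intro j
    cases j with
    | zero => simp [hst]
    | succ j => rw [hs]; exact le_max_right _ _
  have hmono : StrictMono fun j => (st j).2 :=
    strictMono_nat_of_lt_succ fun j => Nat.lt_of_succ_le (by rw [hs]; exact le_max_left _ _)
  have hstab : ∀ i j n, i ≤ j → n ≤ (st i).2 → (st j).1.coeff n = (st i).1.coeff n := by
    intro i j n hij hn
    induction j, hij using Nat.le_induction with
    | base => rfl
    | succ j hj ih =>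
      rw [hs, Polynomial.coeff_add, ih,
        (hqa j (st j)).1 n (hn.trans (hmono.monotone hj)), add_zero]
  have hbound : ∀ j n, ‖(st j).1.coeff n‖ ≤ Real.exp (c n) := by
    intro j n
    induction j with
    | zero => simp [hst, Real.exp_nonneg]
    | succ j ih =>
      rw [hs, Polynomial.coeff_add]
      rcases le_or_gt n (st j).2 with h | h
      · rwa [(hqa j (st j)).1 n h, add_zero]
      · rw [Polynomial.coeff_eq_zero_of_natDegree_lt ((hdeg j).trans_lt h), zero_add]
        exact (hqa j (st j)).2 n
  -- The nth cutoff is at least n, so the nth coefficient no longer changes from stage n on.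
  refine ⟨fun n => (st n).1.coeff n, fun j => (st (j + 1)).2, fun n => hbound n n,
    fun i j hij => hmono (Nat.succ_lt_succ hij), fun j => (Nat.zero_le _).trans_lt (hmono j.succ_pos),
    fun j z hz => ?_⟩
  have h := hqb j (st j) z hz
  have heq : ∑ n ∈ Finset.range ((st (j + 1)).2 + 1), (st n).1.coeff n * (z : ℂ) ^ n =
      ((st j).1 + q j (st j)).eval (z : ℂ) := by
    change _ = (st (j + 1)).1.eval (z : ℂ)
    rw [Polynomial.eval_eq_sum_range' (Nat.lt_succ_of_le (hdeg (j + 1)))]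
    refine Finset.sum_congr rfl fun n hn => ?_
    congr 1
    rcases le_total n (j + 1) with h' | h'
    · exact (hstab n (j + 1) n h' (hmono.id_le n)).symm
    · exact hstab (j + 1) n n h' (Nat.lt_succ_iff.1 (Finset.mem_range.1 hn))
  rwa [heq]

lemma exists_isUniversalSeries_tau {c : ℕ → ℝ} (hc : ClassXPlus c) :
    ∃ a : ℤ → ℂ, (∀ n : ℤ, ‖a n‖ ≤ Real.exp (c n.natAbs)) ∧
      IsUniversalSeries tauTopology (fun n => a n • monomial n) := by
  set d : ℕ → C(Circle, ℂ) := TopologicalSpace.denseSeq C(Circle, ℂ)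
  obtain ⟨A, m, hA, hm, hm0, happ⟩ := exists_coeffs_approx hc fun j => d j.unpair.1
  refine ⟨extendByZero A, fun n => ?_, fun y => ?_⟩
  · cases n with
    | ofNat n => exact hA n
    | negSucc n => simp [extendByZero, Real.exp_nonneg]
  · obtain ⟨φ, hφ, hφy⟩ := extraction_forall_of_frequently
      (P := fun i j => ‖d j.unpair.1 - y‖ < 1 / ((i : ℝ) + 1)) fun i => by
        obtain ⟨r, hr⟩ := (TopologicalSpace.denseRange_denseSeq C(Circle, ℂ)).exists_dist_lt y
          (ε := 1 / ((i : ℝ) + 1)) (by positivity)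
        -- The first component of unpairing takes the value r at the arbitrarily large indices
        -- `Nat.pair r b`, so every target recurs infinitely often.
        refine frequently_atTop.2 fun b => ⟨Nat.pair r b, Nat.right_le_pair r b, ?_⟩
        rw [Nat.unpair_pair, ← dist_eq_norm, dist_comm]
        exact hr
    refine ⟨fun i => m (φ i), hm.comp hφ, fun i => hm0 _, tendsto_tau_iff.2 fun k ε hε => ?_⟩
    obtain ⟨I, hI⟩ := exists_nat_one_div_lt (half_pos (half_pos hε))
    filter_upwards [eventually_ge_atTop (max I k)] with i hi
    have hIi : I ≤ i := (le_max_left _ _).trans hi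
    have hki : (k : ℕ) ≤ i := (le_max_right _ _).trans hi
    refine (arcSeminorm_le (C := ε / 2) (half_pos hε).le fun z hz => ?_).trans_lt (half_lt_self hε)
    have hz' : z ∈ arc (φ i).succPNat := by
      refine arc_mono ?_ hz
      rw [← PNat.coe_le_coe, Nat.succPNat_coe]
      exact (hki.trans (hφ.id_le i)).trans (Nat.le_succ _)
    have h1 := happ (φ i) z hz'
    have h2 := ((d (φ i).unpair.1 - y).norm_coe_le_norm z).trans_lt (hφy i)
    have h3 : 1 / ((i : ℝ) + 1) ≤ 1 / ((I : ℝ) + 1) := by gcongr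
    have h4 : 1 / ((φ i : ℝ) + 1) ≤ 1 / ((i : ℝ) + 1) := by
      gcongr
      exact hφ.id_le i
    rw [ContinuousMap.sub_apply] at h2
    rw [ContinuousMap.sub_apply, sum_smul_monomial_apply, partialSum_extendByZero,
      ← sub_add_sub_cancel _ (d (φ i).unpair.1 z) (y z)]
    refine (norm_add_le _ _).trans ?_
    linarith

lemma IsUniversalSeries.mono {X : Type*} [AddCommGroup X] {s t : TopologicalSpace X} (h : s ≤ t)
    {x : ℤ → X} (hx : IsUniversalSeries s x) : IsUniversalSeries t x := fun y => by
  obtain ⟨n, h1, h2, h3⟩ := hx y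
  exact ⟨n, h1, h2, h3.mono_right (nhds_mono h)⟩

lemma limitFunctions_univ_of_isUniversalSeries {a : ℤ → ℂ}
    (ha : IsUniversalSeries pointwiseTopology fun n => a n • monomial n) :
    limitFunctions a Set.univ = Set.univ := by
  refine Set.eq_univ_of_forall fun g => ?_
  obtain ⟨m, h1, h2, h3⟩ := ha ⟨fun z => g ⟨z, trivial⟩, by fun_prop⟩
  refine ⟨m, h1, h2, fun z => ?_⟩
  have h := tendsto_pointwise_iff.1 h3 z
  simp only [sum_smul_monomial_apply] at h
  exact h

end UniversalTrig
end

theorem theorem1p7 :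
    -- the topology of uniform convergence on the arcs is metrizable and finer than the pointwise one
    @TopologicalSpace.MetrizableSpace C(Circle, ℂ) UniversalTrig.tauTopology ∧
    UniversalTrig.tauTopology ≤ UniversalTrig.pointwiseTopology ∧
    ∀ c : ℕ → ℝ, UniversalTrig.ClassXPlus c →
      ∃ a : ℤ → ℂ, (∀ n : ℤ, ‖a n‖ ≤ Real.exp (c n.natAbs)) ∧
        UniversalTrig.IsUniversalSeries UniversalTrig.pointwiseTopology
          (fun n => a n • UniversalTrig.monomial n) ∧
        UniversalTrig.limitFunctions a Set.univ = Set.univ ∧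
        UniversalTrig.IsUniversalSeries UniversalTrig.tauTopology
          (fun n => a n • UniversalTrig.monomial n) := by
  refine ⟨UniversalTrig.metrizableSpace_tau, UniversalTrig.tau_le_pointwise, fun c hc => ?_⟩
  obtain ⟨a, ha, hu⟩ := UniversalTrig.exists_isUniversalSeries_tau hc
  have hp := hu.mono UniversalTrig.tau_le_pointwise
  exact ⟨a, ha, hp, UniversalTrig.limitFunctions_univ_of_isUniversalSeries hp, hu⟩
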